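/- Let $\beta\in(0,1/2]$, $\theta>0$ and $\tau>0$ be constants. There is a function $\varepsilon:\mathbb N\to\mathbb R$, depending only on $\beta,\theta,\tau$, with $\varepsilon(D)\to 0$ as $D\to\infty$, such that the following holds. Let $d_1,d_2,D_1,D_2$ be positive integers, put $D:=D_1+D_2$, and suppose that 1. $\frac{d_1}{d_2}=\frac{D_2}{D_1}$, 2. $1\ge\frac{d_1}{d_2}\ge\frac{\beta}{1-\beta}$, 3. $\theta\sqrt D/2\le d_1+d_2\le\theta\sqrt D$, 4. $d_1\le D_2$ (this is necessary for a graph as below to exist, and it follows from 1 and 3 whenever $D\ge\theta^2$). Then there is a simple bipartite graph $H$ with $D_1$ left vertices, all of degree $d_1$, and $D_2$ right vertices, all of degree $d_2$ (a $(d_1,d_2)$-biregular graph), such that $$P_H(t)\ \ge\ (1-\varepsilon(D))\cdot d_1\cdot \exp(-\theta t/\sqrt D)\qquad\text{for all real } t \text{ with } 1\le t\le\tau\sqrt D.$$ Here $P_H$ is the unique-neighbor expansion profile of $H$, $$P_H(t):=\min_{\emptyset\ne S\subseteq V(H),\ |S|\le t}\frac{|\mathrm{UN}_H(S)|}{|S|}\qquad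 (t\ge1),$$ where $\mathrm{UN}_H(S)$ is the set of vertices of $H$ (inside or outside $S$) that have exactly one neighbor in $S$. -/

import Mathlib

open Filter Topology

/-- A simple graph on the vertex set `[n₁] ⊔ [n₂]` is a `(d₁, d₂)`-biregular bipartite graph if every
edge joins a left vertex to a right vertex, every left vertex has degree `d₁`, and every right
vertex has degree `d₂`. -/
structure IsBiregular {n₁ n₂ : ℕ} (H : SimpleGraph (Fin n₁ ⊕ Fin n₂)) (d₁ d₂ : ℕ) : Prop where
  bipartite : H.IsBipartiteWith (Set.range Sum.inl) (Set.range Sum.inr)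
  degree_left : ∀ u : Fin n₁, (H.neighborSet (Sum.inl u)).ncard = d₁
  degree_right : ∀ v : Fin n₂, (H.neighborSet (Sum.inr v)).ncard = d₂

open Classical in
/-- `UN_H(S)`: the vertices of `H` (inside or outside `S`) with exactly one edge to `S`. -/
noncomputable def uniqueNeighbors {V : Type*} [Fintype V] (H : SimpleGraph V) (S : Finset V) :
    Finset V :=
  Finset.univ.filter fun v => ∃! u, u ∈ S ∧ H.Adj u v

/-- The unique-neighbor expansion profile `P_H(t)`: the minimum of `|UN_H(S)| / |S|` over the
nonempty vertex sets `S` with `|S| ≤ t`. For `t ≥ 1` and nonempty `V` the infimum is over a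
nonempty finite set, so it is attained, see `expansionProfile_isLeast`. -/
noncomputable def expansionProfile {V : Type*} [Fintype V] (H : SimpleGraph V) (t : ℝ) : ℝ :=
  sInf {r : ℝ | ∃ S : Finset V, S.Nonempty ∧ (S.card : ℝ) ≤ t ∧
    r = ((uniqueNeighbors H S).card : ℝ) / (S.card : ℝ)}

theorem expansionProfile_isLeast {V : Type*} [Fintype V] [Nonempty V] (H : SimpleGraph V)
    {t : ℝ} (ht : 1 ≤ t) :
    IsLeast {r : ℝ | ∃ S : Finset V, S.Nonempty ∧ (S.card : ℝ) ≤ t ∧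
      r = ((uniqueNeighbors H S).card : ℝ) / (S.card : ℝ)} (expansionProfile H t) := by
  have hfin : {r : ℝ | ∃ S : Finset V, S.Nonempty ∧ (S.card : ℝ) ≤ t ∧
      r = ((uniqueNeighbors H S).card : ℝ) / (S.card : ℝ)}.Finite := by
    refine (Set.finite_range fun S : Finset V =>
      ((uniqueNeighbors H S).card : ℝ) / (S.card : ℝ)).subset ?_
    rintro r ⟨S, -, -, rfl⟩
    exact ⟨S, rfl⟩
  refine ⟨Set.Nonempty.csInf_mem ?_ hfin, fun r hr => csInf_le hfin.bddBelow hr⟩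
  obtain ⟨v⟩ := ‹Nonempty V›
  exact ⟨_, {v}, Finset.singleton_nonempty v, by simpa using ht, rfl⟩

/-!
A random bipartite graph of slightly smaller density than required is, up to few missing edges, the
graph sought.

Put `ρ = d₁ / D₂ = d₂ / D₁ ≤ θ / √D`. Join every left vertex to every right vertex independently
with probability `p = (1 - η) * ρ`. For a set `S` of `s` left vertices the `D₂` right vertices are
independently unique neighbors of `S` with probability `s * p * (1 - p) ^ (s - 1)`, so the expected
number of unique neighbors is at least `(1 - η) * d₁ * s * exp (-θ * s / √D)`. As `s` is at most
`τ * √D`, this is at least a constant times `s * √D`, and a Chernoff bound makes a deficit unlikely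
enough (`exp (-c * s * √D)`) for a union bound over the at most `D ^ s` sets of size `s`. The same
argument applies to right sets, and it also keeps every degree strictly below, but within a
proportion `2 * η` of, the target `d₁` or `d₂`. This is `exists_typical`.

Such a graph is then completed to an exactly biregular one by adding edges
(`exists_biregular_superset`). At most `2 * η * d₁` edges are added at each left vertex, so `S` loses
at most `2 * η * d₁ * s` unique neighbors (`uniqueColumns_ge_of_le`), a small proportion once `η` is
small. A set meeting both sides has the unique neighbors of its two halves, on opposite sides, and
since `exp (-θ * s / √D)` decreases in `s` the two bounds add up (`le_expansionProfile_relGraph`).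

For small `D` the error `1` is allowed, but a biregular graph must still exist:
`exists_biregular_relation`. A diagonal choice of `e` turns "for all `e > 0` and all large `D`" into
an error function (`exists_tendsto_zero_of_eventually`).
-/

/-! ### Relations between two finite types as bipartite graphs -/

open scoped Classical in
/-- The degree of `a` in the bipartite graph given by `R`. The degree of `b : β` is
`rowDegree (fun b a => R a b) b`: one definition serves both sides. -/
noncomputable def rowDegree {α β : Type*} [Fintype β] (R : α → β → Prop) (a : α) : ℕ :=
  (Finset.univ.filter fun b => R a b).card

theorem rowDegree_eq_card {α β : Type*} [Fintype β] (R : α → β → Prop) (a : α)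
    [DecidablePred (R a)] : rowDegree R a = (Finset.univ.filter fun b => R a b).card := by
  unfold rowDegree
  congr!

open scoped Classical in
/-- The elements of `β` related to exactly one element of `S`. -/
noncomputable def uniqueColumns {α β : Type*} [Fintype β] (R : α → β → Prop) (S : Finset α) :
    Finset β :=
  Finset.univ.filter fun b => ∃! a, a ∈ S ∧ R a b

/-- The bipartite graph on the disjoint union `α ⊕ β` whose edges are the pairs related by `R`. -/
def relGraph {α β : Type*} (R : α → β → Prop) : SimpleGraph (α ⊕ β) where
  Adj x y := match x, y with
    | Sum.inl a, Sum.inr b => R a b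
    | Sum.inr b, Sum.inl a => R a b
    | _, _ => False
  symm := ⟨by rintro (a | b) (a' | b') h <;> exact h⟩
  loopless := ⟨by rintro (a | b) h <;> exact h⟩

theorem isBiregular_relGraph {n₁ n₂ d₁ d₂ : ℕ} {R : Fin n₁ → Fin n₂ → Prop}
    (h₁ : ∀ a, rowDegree R a = d₁) (h₂ : ∀ b, rowDegree (fun b a => R a b) b = d₂) :
    IsBiregular (relGraph R) d₁ d₂ := by
  classical
  refine ⟨⟨?_, ?_⟩, fun u => ?_, fun v => ?_⟩
  · rw [Set.disjoint_left]
    rintro _ ⟨a, rfl⟩ ⟨b, hb⟩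
    cases hb
  · rintro (a | b) (a' | b') h
    · exact h.elim
    · exact Or.inl ⟨⟨a, rfl⟩, ⟨b', rfl⟩⟩
    · exact Or.inr ⟨⟨b, rfl⟩, ⟨a', rfl⟩⟩
    · exact h.elim
  · have : (relGraph R).neighborSet (Sum.inl u)
        = Sum.inr '' ((Finset.univ.filter fun b => R u b : Finset (Fin n₂)) : Set (Fin n₂)) := by
      ext (a | b)
      · simp [relGraph]
      · simp [relGraph]
    rw [this, Set.ncard_image_of_injective _ Sum.inr_injective, Set.ncard_coe_finset, ← h₁ u,
      rowDegree_eq_card]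
  · have : (relGraph R).neighborSet (Sum.inr v)
        = Sum.inl '' ((Finset.univ.filter fun a => R a v : Finset (Fin n₁)) : Set (Fin n₁)) := by
      ext (a | b)
      · simp [relGraph]
      · simp [relGraph]
    rw [this, Set.ncard_image_of_injective _ Sum.inl_injective, Set.ncard_coe_finset, ← h₂ v,
      rowDegree_eq_card]

/-- The two sides of a vertex set do not interact: the right unique neighbors are governed by the
left half of the set, and the left ones by its right half. -/
theorem card_uniqueNeighbors_relGraph {α β : Type*} [Fintype α] [Fintype β] (R : α → β → Prop)
    (S : Finset (α ⊕ β)) :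
    (uniqueNeighbors (relGraph R) S).card = (uniqueColumns R S.toLeft).card +
      (uniqueColumns (fun b a => R a b) S.toRight).card := by
  classical
  have h : uniqueNeighbors (relGraph R) S =
      (uniqueColumns (fun b a => R a b) S.toRight).disjSum (uniqueColumns R S.toLeft) := by
    ext (a | b)
    · simp only [uniqueNeighbors, uniqueColumns, Finset.mem_filter, Finset.mem_univ, true_and,
        Finset.inl_mem_disjSum, Finset.mem_toRight]
      constructor
      · rintro ⟨(x | x), hx, hu⟩
        · exact hx.2.elim
        · exact ⟨x, hx, fun y hy => Sum.inr_injective (hu _ hy)⟩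
      · rintro ⟨x, hx, hu⟩
        refine ⟨Sum.inr x, hx, ?_⟩
        rintro (y | y) hy
        · exact hy.2.elim
        · exact congrArg _ (hu y hy)
    · simp only [uniqueNeighbors, uniqueColumns, Finset.mem_filter, Finset.mem_univ, true_and,
        Finset.inr_mem_disjSum, Finset.mem_toLeft]
      constructor
      · rintro ⟨(x | x), hx, hu⟩
        · exact ⟨x, hx, fun y hy => Sum.inl_injective (hu _ hy)⟩
        · exact hx.2.elim
      · rintro ⟨x, hx, hu⟩
        refine ⟨Sum.inl x, hx, ?_⟩
        rintro (y | y) hy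
        · exact congrArg _ (hu y hy)
        · exact hy.2.elim
  rw [h, Finset.card_disjSum, add_comm]

/-- Adding edges destroys at most one unique neighbor of `S` per added edge at `S`. -/
theorem card_uniqueColumns_le_of_le {α β : Type*} [Fintype β] {R R' : α → β → Prop}
    (h : ∀ a b, R a b → R' a b) (S : Finset α) :
    (uniqueColumns R S).card + ∑ a ∈ S, rowDegree R a ≤
      (uniqueColumns R' S).card + ∑ a ∈ S, rowDegree R' a := by
  classical
  have hsub : uniqueColumns R S ⊆ uniqueColumns R' S ∪
      S.biUnion fun a => Finset.univ.filter fun b => R' a b ∧ ¬ R a b := by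
    intro b hb
    simp only [uniqueColumns, Finset.mem_filter, Finset.mem_univ, true_and, Finset.mem_union,
      Finset.mem_biUnion] at hb ⊢
    obtain ⟨a, ⟨haS, hab⟩, hu⟩ := hb
    by_cases hc : ∃ a ∈ S, R' a b ∧ ¬ R a b
    · exact Or.inr hc
    · push Not at hc
      exact Or.inl ⟨a, ⟨haS, h _ _ hab⟩, fun y hy => hu y ⟨hy.1, hc y hy.1 hy.2⟩⟩
  have hdeg : ∀ a, (Finset.univ.filter fun b => R' a b ∧ ¬ R a b).card + rowDegree R a
      = rowDegree R' a := by
    intro a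
    rw [rowDegree, rowDegree, ← Finset.card_union_of_disjoint]
    · congr 1
      ext b
      simp only [Finset.mem_union, Finset.mem_filter, Finset.mem_univ, true_and]
      have := h a b
      tauto
    · rw [Finset.disjoint_left]
      intro b hb hb'
      simp only [Finset.mem_filter, Finset.mem_univ, true_and] at hb hb'
      exact hb.2 hb'
  have h1 := (Finset.card_le_card hsub).trans (Finset.card_union_le _ _)
  have h2 := Finset.card_biUnion_le (s := S)
    (t := fun a => Finset.univ.filter fun b => R' a b ∧ ¬ R a b)
  have h3 : ∑ a ∈ S, (Finset.univ.filter fun b => R' a b ∧ ¬ R a b).card + ∑ a ∈ S, rowDegree R a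
      = ∑ a ∈ S, rowDegree R' a := by
    rw [← Finset.sum_add_distrib]
    exact Finset.sum_congr rfl fun a _ => hdeg a
  omega

theorem sum_rowDegree_mem {α β : Type*} [Fintype α] [Fintype β] (E : Finset (α × β)) :
    ∑ a, rowDegree (fun a b => (a, b) ∈ E) a = E.card := by
  classical
  rw [Finset.card_eq_sum_card_fiberwise (f := Prod.fst) (t := Finset.univ) (by simp)]
  refine Finset.sum_congr rfl fun a _ => ?_
  rw [rowDegree]
  refine Finset.card_bij (fun b _ => (a, b)) ?_ ?_ ?_
  · intro b hb
    simpa using hb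
  · intro b _ b' _ h
    exact (Prod.mk.inj h).2
  · rintro ⟨a', b⟩ hb
    simp only [Finset.mem_filter] at hb
    obtain ⟨hb, rfl⟩ := hb
    exact ⟨b, by simpa using hb, rfl⟩

theorem sum_rowDegree_swap_mem {α β : Type*} [Fintype α] [Fintype β] (E : Finset (α × β)) :
    ∑ b, rowDegree (fun b a => (a, b) ∈ E) b = E.card := by
  classical
  have h := sum_rowDegree_mem (E.map (Equiv.prodComm α β).toEmbedding)
  rw [Finset.card_map] at h
  rw [← h]
  refine Finset.sum_congr rfl fun b _ => ?_
  congr! 2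
  simp

/-! ### Biregular relations -/

/-- Blocks of `d₁` consecutive residues modulo `D₂`, laid end to end, form a biregular relation. -/
theorem exists_biregular_relation {d₁ d₂ D₁ D₂ : ℕ} (h : d₁ * D₁ = d₂ * D₂) (hd : d₁ ≤ D₂)
    (h₁ : 0 < d₁) :
    ∃ R : Fin D₁ → Fin D₂ → Prop, (∀ a, rowDegree R a = d₁) ∧
      ∀ b, rowDegree (fun b a => R a b) b = d₂ := by
  classical
  have hD₂ : 0 < D₂ := h₁.trans_le hd
  refine ⟨fun a b => ∃ j < d₁, (a * d₁ + j) % D₂ = b, fun a => ?_, fun b => ?_⟩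
  · rw [rowDegree]
    conv_rhs => rw [← Finset.card_range d₁]
    symm
    refine Finset.card_bij (fun j _ => (⟨(a * d₁ + j) % D₂, Nat.mod_lt _ hD₂⟩ : Fin D₂)) ?_ ?_ ?_
    · intro j hj
      simp only [Finset.mem_filter, Finset.mem_univ, true_and]
      exact ⟨j, Finset.mem_range.1 hj, rfl⟩
    · intro j hj k hk hjk
      have hm : a * d₁ + j ≡ a * d₁ + k [MOD D₂] := congrArg Fin.val hjk
      have := Nat.ModEq.add_left_cancel' _ hm
      exact this.eq_of_lt_of_lt ((Finset.mem_range.1 hj).trans_le hd)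
        ((Finset.mem_range.1 hk).trans_le hd)
    · intro b hb
      simp only [Finset.mem_filter, Finset.mem_univ, true_and] at hb
      obtain ⟨j, hj, hb⟩ := hb
      exact ⟨j, Finset.mem_range.2 hj, Fin.ext hb⟩
  · -- the `d₂` numbers `b + k * D₂ < d₁ * D₁` lie in pairwise distinct blocks
    rw [rowDegree]
    conv_rhs => rw [← Finset.card_range d₂]
    symm
    have hlt : ∀ k < d₂, b + k * D₂ < D₁ * d₁ := by
      intro k hk
      have : (k + 1) * D₂ ≤ d₂ * D₂ := Nat.mul_le_mul_right _ hk
      have := b.2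
      nlinarith
    refine Finset.card_bij (fun k hk => (⟨(b + k * D₂) / d₁,
      Nat.div_lt_of_lt_mul (by rw [mul_comm d₁]; exact hlt k (Finset.mem_range.1 hk))⟩ : Fin D₁))
      ?_ ?_ ?_
    · intro k hk
      simp only [Finset.mem_filter, Finset.mem_univ, true_and]
      refine ⟨(b + k * D₂) % d₁, Nat.mod_lt _ h₁, ?_⟩
      rw [Nat.div_add_mod', Nat.add_mul_mod_self_right, Nat.mod_eq_of_lt b.2]
    · have key : ∀ k l : ℕ, k < l → (b + k * D₂) / d₁ ≠ (b + l * D₂) / d₁ := by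
        intro k l hkl heq
        have e1 := Nat.div_add_mod' (b + k * D₂) d₁
        have e2 := Nat.div_add_mod' (b + l * D₂) d₁
        have e3 := Nat.mod_lt (b + l * D₂) h₁
        rw [← heq] at e2
        have : (k + 1) * D₂ ≤ l * D₂ := Nat.mul_le_mul_right _ hkl
        rw [add_mul, one_mul] at this
        omega
      intro k _ l _ hkl
      have hkl := congrArg Fin.val hkl
      rcases lt_trichotomy k l with hlt | rfl | hlt
      · exact (key _ _ hlt hkl).elim
      · rfl
      · exact (key _ _ hlt hkl.symm).elim
    · intro a ha
      simp only [Finset.mem_filter, Finset.mem_univ, true_and] at ha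
      obtain ⟨j, hj, hb⟩ := ha
      have hdm := Nat.mod_add_div (a.1 * d₁ + j) D₂
      rw [hb] at hdm
      have hb' : b.1 + (a.1 * d₁ + j) / D₂ * D₂ = j + d₁ * a.1 := by rw [mul_comm _ D₂, hdm]; ring
      refine ⟨(a.1 * d₁ + j) / D₂, Finset.mem_range.2 ?_, Fin.ext ?_⟩
      · refine Nat.div_lt_of_lt_mul ?_
        have : (a + 1) * d₁ ≤ D₁ * d₁ := Nat.mul_le_mul_right _ a.2
        nlinarith
      · simp only
        rw [hb', Nat.add_mul_div_left _ _ h₁, Nat.div_eq_of_lt hj, zero_add]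

theorem rowDegree_mem_erase {α β : Type*} [Fintype β] [DecidableEq α] [DecidableEq β]
    {E : Finset (α × β)} {x : α} {y : β} (h : (x, y) ∈ E) (a : α) :
    rowDegree (fun a b => (a, b) ∈ E.erase (x, y)) a + (if a = x then 1 else 0) =
      rowDegree (fun a b => (a, b) ∈ E) a := by
  classical
  simp only [rowDegree]
  split_ifs with hax
  · subst hax
    rw [← Finset.card_erase_add_one (s := Finset.univ.filter fun b => (a, b) ∈ E) (a := y)
      (by simpa using h)]
    congr 2
    ext b
    simp
  · rw [add_zero]
    congr 1
    ext b
    simp [hax]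

theorem rowDegree_mem_insert {α β : Type*} [Fintype β] [DecidableEq α] [DecidableEq β]
    {E : Finset (α × β)} {x : α} {y : β} (h : (x, y) ∉ E) (a : α) :
    rowDegree (fun a b => (a, b) ∈ insert (x, y) E) a =
      rowDegree (fun a b => (a, b) ∈ E) a + (if a = x then 1 else 0) := by
  have := rowDegree_mem_erase (Finset.mem_insert_self (x, y) E) a
  rw [Finset.erase_insert h] at this
  exact this.symm

theorem rowDegree_swap_mem_erase {α β : Type*} [Fintype α] [DecidableEq α] [DecidableEq β]
    {E : Finset (α × β)} {x : α} {y : β} (h : (x, y) ∈ E) (b : β) :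
    rowDegree (fun b a => (a, b) ∈ E.erase (x, y)) b + (if b = y then 1 else 0) =
      rowDegree (fun b a => (a, b) ∈ E) b := by
  classical
  simp only [rowDegree]
  split_ifs with hby
  · subst hby
    rw [← Finset.card_erase_add_one (s := Finset.univ.filter fun a => (a, b) ∈ E) (a := x)
      (by simpa using h)]
    congr 2
    ext a
    simp
  · rw [add_zero]
    congr 1
    ext a
    simp [hby]

theorem rowDegree_swap_mem_insert {α β : Type*} [Fintype α] [DecidableEq α] [DecidableEq β]
    {E : Finset (α × β)} {x : α} {y : β} (h : (x, y) ∉ E) (b : β) :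
    rowDegree (fun b a => (a, b) ∈ insert (x, y) E) b =
      rowDegree (fun b a => (a, b) ∈ E) b + (if b = y then 1 else 0) := by
  have := rowDegree_swap_mem_erase (Finset.mem_insert_self (x, y) E) b
  rw [Finset.erase_insert h] at this
  exact this.symm

/-- A bipartite graph with degrees at most `d₁` and `d₂` that misses more than `3 * d₁ * d₂` edges
extends to a biregular one. An extension with the most edges works: as long as some `u` and `v` are
deficient, either few edges have been added, so many left vertices are deficient and one of them is
not yet joined to `v`, or some added edge `x y` can be replaced by the two edges `u y` and
`x v`. -/
theorem exists_biregular_superset {α β : Type*} [Fintype α] [Fintype β] {d₁ d₂ : ℕ}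
    (hcard : Fintype.card α * d₁ = Fintype.card β * d₂) (G : Finset (α × β))
    (h₁ : ∀ a, rowDegree (fun a b => (a, b) ∈ G) a ≤ d₁)
    (h₂ : ∀ b, rowDegree (fun b a => (a, b) ∈ G) b ≤ d₂)
    (hG : G.card + 3 * d₁ * d₂ < Fintype.card α * d₁) :
    ∃ H : Finset (α × β), G ⊆ H ∧ (∀ a, rowDegree (fun a b => (a, b) ∈ H) a = d₁) ∧
      ∀ b, rowDegree (fun b a => (a, b) ∈ H) b = d₂ := by
  classical
  obtain ⟨H, hH, hmax⟩ := Finset.exists_max_image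
    (Finset.univ.filter fun H : Finset (α × β) => G ⊆ H ∧
      (∀ a, rowDegree (fun a b => (a, b) ∈ H) a ≤ d₁) ∧
      ∀ b, rowDegree (fun b a => (a, b) ∈ H) b ≤ d₂) Finset.card
    ⟨G, by simpa using ⟨h₁, h₂⟩⟩
  simp only [Finset.mem_filter, Finset.mem_univ, true_and] at hH hmax
  obtain ⟨hGH, hH₁, hH₂⟩ := hH
  have hs₁ := sum_rowDegree_mem H
  have hs₂ := sum_rowDegree_swap_mem H
  have hle : H.card ≤ Fintype.card α * d₁ := by
    rw [← hs₁]
    simpa using Finset.sum_le_card_nsmul Finset.univ _ d₁ fun a _ => hH₁ a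
  rcases hle.eq_or_lt with heq | hlt
  · refine ⟨H, hGH, fun a => ?_, fun b => ?_⟩
    · exact (Finset.sum_eq_sum_iff_of_le fun a _ => hH₁ a).1
        (by rw [hs₁, heq]; simp) a (Finset.mem_univ a)
    · exact (Finset.sum_eq_sum_iff_of_le fun b _ => hH₂ b).1
        (by rw [hs₂, heq, hcard]; simp) b (Finset.mem_univ b)
  exfalso
  obtain ⟨u, hu⟩ : ∃ u, rowDegree (fun a b => (a, b) ∈ H) u < d₁ := by
    by_contra! hc
    have := Finset.card_nsmul_le_sum Finset.univ _ d₁ fun a _ => hc a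
    rw [hs₁] at this
    simp only [Finset.card_univ, smul_eq_mul] at this
    omega
  obtain ⟨v, hv⟩ : ∃ v, rowDegree (fun b a => (a, b) ∈ H) v < d₂ := by
    by_contra! hc
    have := Finset.card_nsmul_le_sum Finset.univ _ d₂ fun b _ => hc b
    rw [hs₂] at this
    simp only [Finset.card_univ, smul_eq_mul] at this
    omega
  -- `v` is adjacent to all deficient left vertices, or an edge could be added
  have hadj : ∀ a, rowDegree (fun a b => (a, b) ∈ H) a < d₁ → (a, v) ∈ H := by
    intro a ha
    by_contra hav
    have := hmax (insert (a, v) H) ⟨hGH.trans (Finset.subset_insert _ _), fun a' => ?_,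
      fun b' => ?_⟩
    · rw [Finset.card_insert_of_notMem hav] at this
      omega
    · rw [rowDegree_mem_insert hav]
      have := hH₁ a'
      split_ifs with h
      · subst h; omega
      · omega
    · rw [rowDegree_swap_mem_insert hav]
      have := hH₂ b'
      split_ifs with h
      · subst h; omega
      · omega
  -- hence few left vertices are deficient, and many edges have been added
  have hmany : Fintype.card α * d₁ ≤ H.card + d₁ * d₂ := by
    have h1 : ∑ _a : α, d₁ ≤ ∑ a, (rowDegree (fun a b => (a, b) ∈ H) a +
        if (a, v) ∈ H then d₁ else 0) := by
      refine Finset.sum_le_sum fun a _ => ?_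
      split_ifs with h
      · omega
      · have := mt (hadj a) h
        omega
    rw [Finset.sum_add_distrib, hs₁, ← Finset.sum_filter] at h1
    simp only [Finset.sum_const, Finset.card_univ, smul_eq_mul] at h1
    have h2 : (Finset.univ.filter fun a => (a, v) ∈ H).card * d₁ ≤ d₂ * d₁ :=
      Nat.mul_le_mul_right _ (rowDegree_eq_card (fun b a => (a, b) ∈ H) v ▸ hv.le)
    linarith
  have hswap : ∃ x y, (x, y) ∈ H ∧ (x, y) ∉ G ∧ (u, y) ∉ H ∧ (x, v) ∉ H := by
    by_contra! hc
    have hsub : H ⊆ G ∪ ((Finset.univ.filter fun y => (u, y) ∈ H).biUnion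
        (fun y => (Finset.univ.filter fun x => (x, y) ∈ H).image fun x => (x, y)) ∪
        (Finset.univ.filter fun x => (x, v) ∈ H).biUnion
        (fun x => (Finset.univ.filter fun y => (x, y) ∈ H).image fun y => (x, y))) := by
      rintro ⟨x, y⟩ hxy
      simp only [Finset.mem_union, Finset.mem_biUnion, Finset.mem_filter, Finset.mem_univ,
        true_and, Finset.mem_image]
      by_cases h1 : (x, y) ∈ G
      · exact Or.inl h1
      by_cases h2 : (u, y) ∈ H
      · exact Or.inr (Or.inl ⟨y, h2, x, hxy, rfl⟩)
      · exact Or.inr (Or.inr ⟨x, hc x y hxy h1 h2, y, hxy, rfl⟩)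
    have c0 := (Finset.card_le_card hsub).trans ((Finset.card_union_le _ _).trans
      (Nat.add_le_add_left (Finset.card_union_le _ _) _))
    have c1 := Finset.card_biUnion_le_card_mul (Finset.univ.filter fun y => (u, y) ∈ H)
      (fun y => (Finset.univ.filter fun x => (x, y) ∈ H).image fun x => (x, y)) d₂
      fun y _ => Finset.card_image_le.trans (rowDegree_eq_card (fun b a => (a, b) ∈ H) y ▸ hH₂ y)
    have c2 := Finset.card_biUnion_le_card_mul (Finset.univ.filter fun x => (x, v) ∈ H)
      (fun x => (Finset.univ.filter fun y => (x, y) ∈ H).image fun y => (x, y)) d₁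
      fun x _ => Finset.card_image_le.trans (rowDegree_eq_card (fun a b => (a, b) ∈ H) x ▸ hH₁ x)
    have c3 : (Finset.univ.filter fun y => (u, y) ∈ H).card * d₂ ≤ d₁ * d₂ :=
      Nat.mul_le_mul_right _ (rowDegree_eq_card (fun a b => (a, b) ∈ H) u ▸ hu.le)
    have c4 : (Finset.univ.filter fun x => (x, v) ∈ H).card * d₁ ≤ d₂ * d₁ :=
      Nat.mul_le_mul_right _ (rowDegree_eq_card (fun b a => (a, b) ∈ H) v ▸ hv.le)
    nlinarith
  obtain ⟨x, y, hxy, hxyG, huy, hxv⟩ := hswap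
  have hxu : x ≠ u := by rintro rfl; exact huy hxy
  have hyv : y ≠ v := by rintro rfl; exact hxv hxy
  have n1 : (u, y) ∉ H.erase (x, y) := fun h => huy (Finset.mem_of_mem_erase h)
  have n2 : (x, v) ∉ insert (u, y) (H.erase (x, y)) := by
    simp [hxu, hxv]
  have := hmax (insert (x, v) (insert (u, y) (H.erase (x, y)))) ⟨?_, fun a => ?_, fun b => ?_⟩
  · rw [Finset.card_insert_of_notMem n2, Finset.card_insert_of_notMem n1,
      Finset.card_erase_add_one hxy] at this
    omega
  · intro e he
    refine Finset.mem_insert_of_mem (Finset.mem_insert_of_mem (Finset.mem_erase.2 ⟨?_, hGH he⟩))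
    rintro rfl
    exact hxyG he
  · have e := rowDegree_mem_erase hxy a
    rw [rowDegree_mem_insert n2, rowDegree_mem_insert n1]
    have := hH₁ a
    by_cases hax : a = x
    · have : a ≠ u := hax ▸ hxu
      simp only [hax, if_true, if_neg hxu] at *
      omega
    · by_cases hau : a = u
      · simp only [hau, if_true, if_neg hxu.symm] at *
        omega
      · simp only [hax, hau, if_false] at *
        omega
  · have e := rowDegree_swap_mem_erase hxy b
    rw [rowDegree_swap_mem_insert n2, rowDegree_swap_mem_insert n1]
    have := hH₂ b
    by_cases hby : b = y
    · simp only [hby, if_true, if_neg hyv] at *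
      omega
    · by_cases hbv : b = v
      · simp only [hbv, if_true, if_neg hyv.symm] at *
        omega
      · simp only [hby, hbv, if_false] at *
        omega

/-! ### Random relations with independent entries -/

/-- The weight of a coin that shows `true` with probability `p`. -/
def coinWeight (p : ℝ) (x : Bool) : ℝ := if x then p else 1 - p

/-- The probability of `A` for a vector of independent coins of bias `p`. -/
noncomputable def rowProb {β : Type*} [Fintype β] (p : ℝ) (A : (β → Bool) → Prop) : ℝ :=
  open scoped Classical in ∑ r : β → Bool, (∏ b, coinWeight p (r b)) * if A r then 1 else 0

/-- The expectation of `f` over a table of independent coins of bias `p`. -/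
noncomputable def tableExpect {α β : Type*} [Fintype α] [Fintype β] (p : ℝ)
    (f : (α → β → Bool) → ℝ) : ℝ :=
  open scoped Classical in ∑ ω : α → β → Bool, (∏ a, ∏ b, coinWeight p (ω a b)) * f ω

/-- The probability of `Q` over a table of independent coins of bias `p`. -/
noncomputable def tableProb {α β : Type*} [Fintype α] [Fintype β] (p : ℝ)
    (Q : (α → β → Bool) → Prop) : ℝ :=
  open scoped Classical in tableExpect p fun ω => if Q ω then 1 else 0

section table

variable {α β : Type*} [Fintype α] [Fintype β] {p : ℝ}

theorem coinWeight_nonneg (hp₀ : 0 ≤ p) (hp₁ : p ≤ 1) (x : Bool) : 0 ≤ coinWeight p x := by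
  unfold coinWeight
  split_ifs <;> linarith

theorem tableExpect_mono (hp₀ : 0 ≤ p) (hp₁ : p ≤ 1) {f g : (α → β → Bool) → ℝ}
    (h : ∀ ω, f ω ≤ g ω) : tableExpect p f ≤ tableExpect p g := by
  classical
  unfold tableExpect
  refine Finset.sum_le_sum fun ω _ => mul_le_mul_of_nonneg_left (h ω) ?_
  exact Finset.prod_nonneg fun a _ => Finset.prod_nonneg fun b _ => coinWeight_nonneg hp₀ hp₁ _

theorem tableProb_mono (hp₀ : 0 ≤ p) (hp₁ : p ≤ 1) {P Q : (α → β → Bool) → Prop}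
    (h : ∀ ω, P ω → Q ω) : tableProb p P ≤ tableProb p Q := by
  classical
  refine tableExpect_mono hp₀ hp₁ fun ω => ?_
  by_cases hP : P ω
  · simp [hP, h ω hP]
  · rw [if_neg hP]
    split_ifs <;> norm_num

theorem sum_prod_coinWeight [DecidableEq β] :
    ∑ r : β → Bool, ∏ b, coinWeight p (r b) = 1 := by
  rw [← Fintype.prod_sum fun (_ : β) x => coinWeight p x]
  simp [coinWeight]

theorem tableExpect_sum {ι : Type*} (s : Finset ι) (f : ι → (α → β → Bool) → ℝ) :
    tableExpect p (fun ω => ∑ i ∈ s, f i ω) = ∑ i ∈ s, tableExpect p (f i) := by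
  classical
  unfold tableExpect
  simp only [Finset.mul_sum]
  exact Finset.sum_comm

theorem tableExpect_const_mul (c : ℝ) (f : (α → β → Bool) → ℝ) :
    tableExpect p (fun ω => c * f ω) = c * tableExpect p f := by
  classical
  unfold tableExpect
  rw [Finset.mul_sum]
  exact Finset.sum_congr rfl fun ω _ => by ring

/-- The rows of a table are independent and identically distributed. -/
theorem tableExpect_prod_rows [DecidableEq β] (h : (β → Bool) → ℝ) :
    tableExpect p (fun ω : α → β → Bool => ∏ a, h (ω a)) =
      (∑ r : β → Bool, (∏ b, coinWeight p (r b)) * h r) ^ Fintype.card α := by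
  classical
  unfold tableExpect
  simp only [← Finset.prod_mul_distrib]
  have := Fintype.prod_sum fun (_ : α) (r : β → Bool) => (∏ b, coinWeight p (r b)) * h r
  rw [Finset.prod_const, Finset.card_univ] at this
  convert this.symm

theorem tableProb_true : tableProb p (fun _ : α → β → Bool => True) = 1 := by
  classical
  have := tableExpect_prod_rows (α := α) (β := β) (p := p) fun _ => 1
  simp only [Finset.prod_const_one, mul_one, sum_prod_coinWeight, one_pow] at this
  simpa [tableProb] using this

theorem tableProb_swap (Q : (α → β → Bool) → Prop) :
    tableProb p (fun ω : β → α → Bool => Q fun a b => ω b a) = tableProb p Q := by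
  classical
  unfold tableProb tableExpect
  refine Fintype.sum_equiv (Equiv.piComm fun _ _ => Bool) _ _ fun ω => ?_
  rw [Finset.prod_comm]
  rfl

theorem tableProb_or_le (hp₀ : 0 ≤ p) (hp₁ : p ≤ 1) (P Q : (α → β → Bool) → Prop) :
    tableProb p (fun ω => P ω ∨ Q ω) ≤ tableProb p P + tableProb p Q := by
  classical
  have h := tableExpect_sum (p := p) Finset.univ
    fun (i : Bool) (ω : α → β → Bool) => if (if i then P ω else Q ω) then (1 : ℝ) else 0
  simp only [Fintype.sum_bool, if_true, Bool.false_eq_true, if_false] at h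
  unfold tableProb
  rw [← h]
  refine tableExpect_mono hp₀ hp₁ fun ω => ?_
  by_cases hP : P ω <;> by_cases hQ : Q ω <;> simp [hP, hQ]

theorem tableProb_exists_le (hp₀ : 0 ≤ p) (hp₁ : p ≤ 1) {ι : Type*} (s : Finset ι)
    (Q : ι → (α → β → Bool) → Prop) :
    tableProb p (fun ω => ∃ i ∈ s, Q i ω) ≤ ∑ i ∈ s, tableProb p (Q i) := by
  classical
  unfold tableProb
  rw [← tableExpect_sum]
  refine tableExpect_mono hp₀ hp₁ fun ω => ?_
  have hnn : ∀ i ∈ s, (0 : ℝ) ≤ if Q i ω then 1 else 0 := fun i _ => by split_ifs <;> norm_num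
  split_ifs with h
  · obtain ⟨i, hi, hQ⟩ := h
    have := Finset.single_le_sum hnn hi
    rwa [if_pos hQ] at this
  · exact Finset.sum_nonneg hnn

/-- The moment generating function of the number of rows with property `A`. -/
theorem tableExpect_exp_card_le (hp₀ : 0 ≤ p) (hp₁ : p ≤ 1) (A : (β → Bool) → Prop) (l : ℝ) :
    open scoped Classical in
    tableExpect p (fun ω : α → β → Bool =>
      Real.exp (l * (Finset.univ.filter fun a => A (ω a)).card)) ≤
      Real.exp ((Real.exp l - 1) * (Fintype.card α * rowProb p A)) := by
  classical
  have h1 : ∀ ω : α → β → Bool, Real.exp (l * (Finset.univ.filter fun a => A (ω a)).card) =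
      ∏ a, (1 + (Real.exp l - 1) * if A (ω a) then 1 else 0) := by
    intro ω
    rw [mul_comm, Real.exp_nat_mul, ← Finset.prod_const, Finset.prod_filter]
    refine Finset.prod_congr rfl fun a _ => ?_
    split_ifs <;> ring
  have h2 : ∑ r : β → Bool, (∏ b, coinWeight p (r b)) *
      (1 + (Real.exp l - 1) * if A r then 1 else 0) = 1 + (Real.exp l - 1) * rowProb p A := by
    simp only [mul_add, Finset.sum_add_distrib, mul_one, sum_prod_coinWeight, rowProb,
      Finset.mul_sum]
    congr 1
    exact Finset.sum_congr rfl fun r _ => by ring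
  have h3 : 0 ≤ 1 + (Real.exp l - 1) * rowProb p A := by
    rw [← h2]
    refine Finset.sum_nonneg fun r _ => mul_nonneg
      (Finset.prod_nonneg fun b _ => coinWeight_nonneg hp₀ hp₁ _) ?_
    split_ifs
    · have := Real.exp_pos l
      linarith
    · simp
  simp only [h1]
  rw [tableExpect_prod_rows (fun r : β → Bool => 1 + (Real.exp l - 1) * if A r then 1 else 0), h2]
  calc _ ≤ Real.exp ((Real.exp l - 1) * rowProb p A) ^ Fintype.card α :=
        pow_le_pow_left₀ h3 (by linarith [Real.add_one_le_exp ((Real.exp l - 1) * rowProb p A)]) _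
    _ = _ := by
        rw [← Real.exp_nat_mul]
        congr 1
        ring

theorem rowProb_nonneg (hp₀ : 0 ≤ p) (hp₁ : p ≤ 1) (A : (β → Bool) → Prop) :
    0 ≤ rowProb p A := by
  unfold rowProb
  refine Finset.sum_nonneg fun r _ => mul_nonneg
      (Finset.prod_nonneg fun b _ => coinWeight_nonneg hp₀ hp₁ _) ?_
  split_ifs <;> norm_num

/-- Chernoff bounds for both tails: `l = -δ / 2` gives the lower and `l = δ / 2` the upper one. -/
theorem tableProb_tail_le (hp₀ : 0 ≤ p) (hp₁ : p ≤ 1) (A : (β → Bool) → Prop) {l : ℝ}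
    (hl : |l| ≤ 1) :
    open scoped Classical in
    tableProb p (fun ω : α → β → Bool => l * ((1 + 2 * l) * (Fintype.card α * rowProb p A)) ≤
      l * (Finset.univ.filter fun a => A (ω a)).card) ≤
      Real.exp (-(l ^ 2 * (Fintype.card α * rowProb p A))) := by
  classical
  set m : ℝ := Fintype.card α * rowProb p A with hm
  have hm0 : 0 ≤ m := mul_nonneg (Nat.cast_nonneg _) (rowProb_nonneg hp₀ hp₁ A)
  calc _ ≤ tableExpect p (fun ω : α → β → Bool => Real.exp (-(l * ((1 + 2 * l) * m))) *
        Real.exp (l * (Finset.univ.filter fun a => A (ω a)).card)) := by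
        refine tableExpect_mono hp₀ hp₁ fun ω => ?_
        rw [← Real.exp_add]
        split_ifs with h
        · rw [Real.one_le_exp_iff]
          linarith
        · exact (Real.exp_pos _).le
    _ ≤ Real.exp (-(l * ((1 + 2 * l) * m))) * Real.exp ((Real.exp l - 1) * m) := by
        rw [tableExpect_const_mul]
        exact mul_le_mul_of_nonneg_left (tableExpect_exp_card_le hp₀ hp₁ A l) (Real.exp_pos _).le
    _ ≤ _ := by
        rw [← Real.exp_add, Real.exp_le_exp]
        have := (abs_le.1 (Real.abs_exp_sub_one_sub_id_le hl)).2
        nlinarith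

/-- A vector of coins has exactly one `true` in `S` with probability `s * p * (1 - p) ^ (s - 1)`,
where `s` is the size of `S`. -/
theorem rowProb_existsUnique (S : Finset β) :
    rowProb p (fun r => ∃! b, b ∈ S ∧ r b = true) = S.card * (p * (1 - p) ^ (S.card - 1)) := by
  classical
  have h1 : ∀ r : β → Bool, (if ∃! b, b ∈ S ∧ r b = true then (1 : ℝ) else 0) =
      ∑ c ∈ S, ∏ b, if b ∈ S then (if b = c then (if r b then 1 else 0) else
        (if r b then 0 else 1)) else 1 := by
    intro r
    have h0 : ∀ c ∈ S, (∏ b, if b ∈ S then (if b = c then (if r b then (1 : ℝ) else 0) else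
        (if r b then 0 else 1)) else 1) =
        if (∀ b ∈ S, r b = true ↔ b = c) then 1 else 0 := by
      intro c hc
      split_ifs with h
      · refine Finset.prod_eq_one fun b _ => ?_
        split_ifs with h1 h2 h3 h4
        · rfl
        · exact (h3 ((h b h1).2 h2)).elim
        · exact (h2 ((h b h1).1 h4)).elim
        · rfl
        · rfl
      · push Not at h
        obtain ⟨b, hb, hbc⟩ := h
        refine Finset.prod_eq_zero (Finset.mem_univ b) ?_
        rw [if_pos hb]
        split_ifs with h1 h2 h3 <;> simp_all
    rw [Finset.sum_congr rfl h0]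
    split_ifs with h
    · obtain ⟨c, hc, hu⟩ := h
      rw [Finset.sum_eq_single_of_mem c hc.1]
      · rw [if_pos]
        exact fun b hb => ⟨fun h => hu b ⟨hb, h⟩, fun h => h ▸ hc.2⟩
      · intro b hb hbc
        rw [if_neg]
        exact fun h => hbc ((h c hc.1).1 hc.2).symm
    · symm
      refine Finset.sum_eq_zero fun c hc => if_neg fun h' => h ?_
      exact ⟨c, ⟨hc, (h' c hc).2 rfl⟩, fun b hb => (h' b hb.1).1 hb.2⟩
  unfold rowProb
  simp only [h1, Finset.mul_sum]
  rw [Finset.sum_comm, ← nsmul_eq_mul, ← Finset.sum_const]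
  refine Finset.sum_congr rfl fun c hc => ?_
  simp only [← Finset.prod_mul_distrib]
  rw [← Fintype.prod_sum fun (b : β) (x : Bool) => coinWeight p x *
    if b ∈ S then (if b = c then (if x then 1 else 0) else (if x then 0 else 1)) else 1]
  have h2 : ∀ b, ∑ x : Bool, (coinWeight p x * if b ∈ S then (if b = c then
      (if x then (1 : ℝ) else 0) else (if x then 0 else 1)) else 1) =
      if b ∈ S then (if b = c then p else 1 - p) else 1 := by
    intro b
    by_cases hb : b ∈ S <;> by_cases hbc : b = c <;> simp [hb, hbc, coinWeight]
  simp only [h2]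
  rw [← Finset.prod_filter, Finset.filter_mem_eq_inter, Finset.univ_inter,
    ← Finset.mul_prod_erase S _ hc, if_pos rfl]
  congr 1
  rw [← Finset.card_erase_of_mem hc, ← Finset.prod_const]
  exact Finset.prod_congr rfl fun b hb => if_neg (Finset.ne_of_mem_erase hb)

end table

/-! ### Random relations have many unique neighbors -/

/-- `R` is atypical towards `α`: some set of at most `K` elements of `β` has too few unique
neighbors in `α`, or some element of `β` has too large degree, compared to `1 - δ` and `1 + δ`
times the expectation for a random relation of density `p`. -/
def Atypical {α β : Type*} [Fintype α] (p δ K : ℝ) (R : α → β → Prop) : Prop :=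
  (∃ S : Finset β, S.Nonempty ∧ (S.card : ℝ) ≤ K ∧ ((uniqueColumns (fun b a => R a b) S).card : ℝ) ≤
      (1 - δ) * (Fintype.card α * (S.card * (p * (1 - p) ^ (S.card - 1))))) ∨
    ∃ b, (1 + δ) * (Fintype.card α * p) ≤ rowDegree (fun b a => R a b) b

/-- A union bound over all small sets, of which the failure probability `x ^ s` for sets of size
`s` leaves a total of `(1 + x) ^ card β - 1`, and over all vertices. -/
theorem tableProb_atypical_lt {α β : Type*} [Fintype α] [Fintype β] {p δ K x : ℝ} (hp₀ : 0 ≤ p)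
    (hp₁ : p ≤ 1) (hδ₀ : 0 < δ) (hδ₁ : δ ≤ 1) (hK : 1 ≤ K)
    (hx : ∀ s : ℕ, 1 ≤ s → (s : ℝ) ≤ K →
      Real.exp (-((δ / 2) ^ 2 * (Fintype.card α * (s * (p * (1 - p) ^ (s - 1)))))) ≤ x ^ s)
    (hx' : Fintype.card β * x ≤ 1 / 8) :
    tableProb p (fun ω : α → β → Bool => Atypical p δ K fun a b => ω a b = true) < 1 / 2 := by
  classical
  have hδ : |δ / 2| ≤ 1 := by rw [abs_le]; constructor <;> linarith
  have hδ' : |-(δ / 2)| ≤ 1 := by rwa [abs_neg]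
  have hx0 : 0 ≤ x := by
    have := (Real.exp_pos _).le.trans (hx 1 le_rfl (by simpa using hK))
    simpa using this
  have hlow : tableProb p (fun ω : α → β → Bool => ∃ S ∈ (Finset.univ.filter fun S : Finset β =>
      S.Nonempty ∧ (S.card : ℝ) ≤ K),
      ((uniqueColumns (fun b a => ω a b = true) S).card : ℝ) ≤
      (1 - δ) * (Fintype.card α * (S.card * (p * (1 - p) ^ (S.card - 1))))) ≤
      (1 + x) ^ Fintype.card β - 1 := by
    refine (tableProb_exists_le hp₀ hp₁ _ _).trans ?_
    have hterm : ∀ S ∈ (Finset.univ.filter fun S : Finset β => S.Nonempty ∧ (S.card : ℝ) ≤ K),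
        tableProb p (fun ω : α → β → Bool =>
          ((uniqueColumns (fun b a => ω a b = true) S).card : ℝ) ≤
          (1 - δ) * (Fintype.card α * (S.card * (p * (1 - p) ^ (S.card - 1))))) ≤ x ^ S.card := by
      intro S hS
      simp only [Finset.mem_filter, Finset.mem_univ, true_and] at hS
      refine le_trans ?_ (hx S.card (Finset.card_pos.2 hS.1) hS.2)
      have h := tableProb_tail_le (α := α) hp₀ hp₁ (fun r : β → Bool => ∃! b, b ∈ S ∧ r b = true)
        hδ'
      rw [rowProb_existsUnique, neg_sq] at h
      refine (tableProb_mono hp₀ hp₁ fun ω hω => ?_).trans h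
      rw [neg_mul, neg_mul, neg_le_neg_iff]
      refine mul_le_mul_of_nonneg_left (le_trans (Nat.cast_le.2 (le_of_eq ?_))
        (hω.trans (le_of_eq ?_))) (by linarith)
      · rw [uniqueColumns]
      · ring
    refine (Finset.sum_le_sum hterm).trans ?_
    have hbin := Fintype.sum_pow_mul_eq_add_pow β x 1
    simp only [one_pow, mul_one] at hbin
    rw [add_comm 1 x, ← hbin, ← Finset.sum_erase_add _ _ (Finset.mem_univ (∅ : Finset β)),
      Finset.card_empty, pow_zero, add_sub_cancel_right]
    refine Finset.sum_le_sum_of_subset_of_nonneg ?_ fun S _ _ => pow_nonneg hx0 _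
    intro S hS
    simp only [Finset.mem_filter, Finset.mem_univ, true_and] at hS
    simpa using hS.1.ne_empty
  have hhigh : tableProb p (fun ω : α → β → Bool => ∃ b ∈ (Finset.univ : Finset β),
      (1 + δ) * (Fintype.card α * p) ≤ rowDegree (fun b a => ω a b = true) b) ≤
      Fintype.card β * x := by
    refine (tableProb_exists_le hp₀ hp₁ _ _).trans ?_
    rw [show (Fintype.card β : ℝ) * x = ∑ _b : β, x by simp]
    refine Finset.sum_le_sum fun (b : β) _ => ?_
    have h := tableProb_tail_le (α := α) hp₀ hp₁
      (fun r : β → Bool => ∃! c, c ∈ ({b} : Finset β) ∧ r c = true) hδ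
    have h1 := hx 1 le_rfl (by simpa using hK)
    rw [rowProb_existsUnique] at h
    simp only [Finset.card_singleton, Nat.cast_one, one_mul, Nat.sub_self, pow_zero, mul_one,
      pow_one] at h h1
    refine le_trans ?_ (h.trans h1)
    refine tableProb_mono hp₀ hp₁ fun ω hω => ?_
    refine mul_le_mul_of_nonneg_left (le_trans (le_of_eq ?_)
      (hω.trans (Nat.cast_le.2 (le_of_eq ?_)))) (by linarith)
    · ring
    · rw [rowDegree]
      congr 1
      ext a
      simp only [Finset.mem_filter, Finset.mem_univ, true_and, Finset.mem_singleton]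
      exact ⟨fun h => ⟨b, ⟨rfl, h⟩, fun c hc => hc.1⟩, fun ⟨c, hc, _⟩ => hc.1 ▸ hc.2⟩
  have hexp : (1 + x) ^ Fintype.card β ≤ 1 + 1 / 8 + (1 / 8) ^ 2 := by
    have h1 : (1 + x) ^ Fintype.card β ≤ Real.exp (1 / 8) := by
      calc (1 + x) ^ Fintype.card β ≤ Real.exp x ^ Fintype.card β :=
            pow_le_pow_left₀ (by linarith) (by linarith [Real.add_one_le_exp x]) _
        _ = Real.exp (Fintype.card β * x) := (Real.exp_nat_mul _ _).symm
        _ ≤ _ := Real.exp_le_exp.2 hx'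
    have h2 := (abs_le.1 (Real.abs_exp_sub_one_sub_id_le (x := 1 / 8)
      (by rw [abs_le]; constructor <;> norm_num))).2
    linarith
  have hor := (tableProb_or_le hp₀ hp₁ _ _).trans (add_le_add hlow hhigh)
  simp only [Finset.mem_filter, Finset.mem_univ, true_and, and_assoc] at hor
  exact lt_of_le_of_lt hor (by linarith)

/-- Some relation is typical in both directions. -/
theorem exists_typical {α β : Type*} [Fintype α] [Fintype β] {p δ K x : ℝ} (hp₀ : 0 ≤ p)
    (hp₁ : p ≤ 1) (hδ₀ : 0 < δ) (hδ₁ : δ ≤ 1) (hK : 1 ≤ K)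
    (hα : ∀ s : ℕ, 1 ≤ s → (s : ℝ) ≤ K →
      Real.exp (-((δ / 2) ^ 2 * (Fintype.card α * (s * (p * (1 - p) ^ (s - 1)))))) ≤ x ^ s)
    (hβ : ∀ s : ℕ, 1 ≤ s → (s : ℝ) ≤ K →
      Real.exp (-((δ / 2) ^ 2 * (Fintype.card β * (s * (p * (1 - p) ^ (s - 1)))))) ≤ x ^ s)
    (hα' : Fintype.card α * x ≤ 1 / 8) (hβ' : Fintype.card β * x ≤ 1 / 8) :
    ∃ R : α → β → Prop, ¬ Atypical p δ K R ∧ ¬ Atypical p δ K fun b a => R a b := by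
  by_contra! hc
  have h1 := tableProb_atypical_lt (α := α) (β := β) hp₀ hp₁ hδ₀ hδ₁ hK hα hβ'
  have h2 := tableProb_atypical_lt (α := β) (β := α) hp₀ hp₁ hδ₀ hδ₁ hK hβ hα'
  rw [← tableProb_swap] at h2
  have h3 := tableProb_or_le hp₀ hp₁
    (fun ω : α → β → Bool => Atypical p δ K fun a b => ω a b = true)
    (fun ω : α → β → Bool => Atypical p δ K fun b a => ω a b = true)
  have h4 : tableProb p (fun _ : α → β → Bool => True) ≤ _ :=
    (tableProb_mono hp₀ hp₁ fun ω _ => ?_).trans h3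
  · rw [tableProb_true] at h4
    linarith
  · by_cases h : Atypical p δ K fun a b => ω a b = true
    · exact Or.inl h
    · exact Or.inr (hc _ h)

/-! ### From typical relations to biregular graphs -/

theorem uniqueColumns_singleton {α β : Type*} [Fintype β] (R : α → β → Prop) (a : α) :
    (uniqueColumns R {a}).card = rowDegree R a := by
  rw [uniqueColumns, rowDegree]
  congr 1
  ext b
  simp only [Finset.mem_filter, Finset.mem_univ, true_and, Finset.mem_singleton]
  exact ⟨fun ⟨c, hc, _⟩ => hc.1 ▸ hc.2, fun h => ⟨a, ⟨rfl, h⟩, fun c hc => hc.1⟩⟩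

/-- The expected number of unique neighbors of a set of size `s`, if the density is
`(1 - η) * ρ` and `n * ρ = d`; here `y` is an upper estimate for `-log (1 - p)`. -/
theorem mean_ge {n s : ℕ} {d ρ η y : ℝ} (hη₀ : 0 < η) (hη₁ : η ≤ 1 / 4) (hρ : 0 ≤ ρ)
    (hn : n * ρ = d) (hs : 1 ≤ s) (hy : 0 ≤ y) (hp : Real.exp (-y) ≤ 1 - (1 - η) * ρ) :
    (1 - η) * d * s * Real.exp (-y * s) ≤
      n * (s * ((1 - η) * ρ * (1 - (1 - η) * ρ) ^ (s - 1))) := by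
  have hpow : Real.exp (-y * s) ≤ (1 - (1 - η) * ρ) ^ (s - 1) := by
    calc Real.exp (-y * s) ≤ Real.exp (((s - 1 : ℕ) : ℝ) * -y) := by
          rw [Real.exp_le_exp, Nat.cast_sub hs, Nat.cast_one]
          nlinarith
      _ = Real.exp (-y) ^ (s - 1) := Real.exp_nat_mul _ _
      _ ≤ _ := pow_le_pow_left₀ (Real.exp_pos _).le hp _
  have hd : 0 ≤ d := hn ▸ mul_nonneg (Nat.cast_nonneg _) hρ
  calc (1 - η) * d * s * Real.exp (-y * s)
      ≤ (1 - η) * d * s * (1 - (1 - η) * ρ) ^ (s - 1) :=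
        mul_le_mul_of_nonneg_left hpow
          (mul_nonneg (mul_nonneg (by linarith) hd) (Nat.cast_nonneg _))
    _ = _ := by rw [← hn]; ring

theorem bounds_of_not_atypical {α β : Type*} [Fintype α] {R : α → β → Prop} {d ρ η y K : ℝ}
    (hη₀ : 0 < η) (hη₁ : η ≤ 1 / 4) (hρ : 0 ≤ ρ) (hn : Fintype.card α * ρ = d) (hy : 0 ≤ y)
    (hp : Real.exp (-y) ≤ 1 - (1 - η) * ρ) (hK : 1 ≤ K)
    (hR : ¬ Atypical ((1 - η) * ρ) (η / 2) K R) :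
    (∀ S : Finset β, S.Nonempty → (S.card : ℝ) ≤ K →
      (1 - 2 * η) * d * S.card * Real.exp (-y * S.card) ≤
        (uniqueColumns (fun b a => R a b) S).card) ∧
    (∀ b, (1 - 2 * η) * d ≤ rowDegree (fun b a => R a b) b) ∧
    ∀ b, (rowDegree (fun b a => R a b) b : ℝ) ≤ (1 - η / 2) * d := by
  simp only [Atypical, not_or, not_exists, not_and, not_le] at hR
  obtain ⟨h₁, h₂⟩ := hR
  have hd : 0 ≤ d := hn ▸ mul_nonneg (Nat.cast_nonneg _) hρ
  have hk₁ : 1 - 2 * η ≤ (1 - η / 2) * (1 - η) := by nlinarith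
  have hk₂ : (1 + η / 2) * (1 - η) ≤ 1 - η / 2 := by nlinarith
  refine ⟨fun S hS hSK => ?_, fun b => ?_, fun b => ?_⟩
  · have hm := mean_ge hη₀ hη₁ hρ hn (Finset.card_pos.2 hS) hy hp
    refine le_trans ?_ (h₁ S hS hSK).le
    refine le_trans ?_ (mul_le_mul_of_nonneg_left hm (by linarith))
    have h0 : 0 ≤ d * S.card * Real.exp (-y * S.card) := by positivity
    linarith [mul_le_mul_of_nonneg_right hk₁ h0]
  · have h := h₁ {b} (Finset.singleton_nonempty b) (by simpa using hK)
    rw [uniqueColumns_singleton] at h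
    refine le_trans ?_ h.le
    simp only [Finset.card_singleton, Nat.cast_one, one_mul, Nat.sub_self, pow_zero, mul_one]
    rw [show (Fintype.card α : ℝ) * ((1 - η) * ρ) = (1 - η) * d by rw [← hn]; ring]
    linarith [mul_le_mul_of_nonneg_right hk₁ hd]
  · refine (h₂ b).le.trans ?_
    rw [show (Fintype.card α : ℝ) * ((1 - η) * ρ) = (1 - η) * d by rw [← hn]; ring]
    linarith [mul_le_mul_of_nonneg_right hk₂ hd]

/-- Completing an almost regular relation to a regular one costs each small set only a small
proportion of its unique neighbors. -/
theorem uniqueColumns_ge_of_le {α β : Type*} [Fintype β] {R R' : α → β → Prop}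
    (h : ∀ a b, R a b → R' a b) {d : ℕ} {η e y L : ℝ} (hd : ∀ a, rowDegree R' a = d)
    (hR : ∀ a, (1 - 2 * η) * d ≤ rowDegree R a) (hη : 0 ≤ η)
    (hηe : η * (2 + 2 * Real.exp L) = e) {S : Finset α} (hL : y * S.card ≤ L)
    (hS : (1 - 2 * η) * d * S.card * Real.exp (-y * S.card) ≤ (uniqueColumns R S).card) :
    (1 - e) * d * S.card * Real.exp (-y * S.card) ≤ (uniqueColumns R' S).card := by
  have h1 : ((uniqueColumns R S).card : ℝ) + ∑ a ∈ S, (rowDegree R a : ℝ) ≤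
      (uniqueColumns R' S).card + ∑ a ∈ S, (rowDegree R' a : ℝ) := by
    exact_mod_cast card_uniqueColumns_le_of_le h S
  have h2 : S.card * ((1 - 2 * η) * d) ≤ ∑ a ∈ S, (rowDegree R a : ℝ) := by
    rw [← nsmul_eq_mul]
    exact Finset.card_nsmul_le_sum _ _ _ fun a _ => hR a
  have h3 : ∑ a ∈ S, (rowDegree R' a : ℝ) = S.card * d := by
    simp [hd]
  have h4 : 1 ≤ Real.exp L * Real.exp (-y * S.card) := by
    rw [← Real.exp_add, Real.one_le_exp_iff]
    linarith
  have h5 : 0 ≤ 2 * η * d * S.card := by positivity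
  have h6 := mul_le_mul_of_nonneg_left h4 h5
  rw [← hηe]
  linarith

/-- The quantitative heart for one choice of parameters: `r` stands for `√(D₁ + D₂)`, `ρ` for the
common edge density `d₁ / D₂ = d₂ / D₁`. -/
theorem exists_biregular_of_large {d₁ d₂ D₁ D₂ : ℕ} {θ τ η e ρ r c : ℝ}
    (hθ : 0 < θ) (hη₀ : 0 < η) (hη₁ : η ≤ 1 / 4)
    (hηe : η * (2 + 2 * Real.exp (θ * τ)) = e) (hr : 0 < r) (hD : ((D₁ + D₂ : ℕ) : ℝ) = r ^ 2)
    (hρ₀ : 0 ≤ ρ) (hρ : ρ ≤ θ / r) (h₁ : D₂ * ρ = d₁) (h₂ : D₁ * ρ = d₂) (h₁₂ : d₁ ≤ d₂)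
    (hc : c * r ≤ (η / 4) ^ 2 * ((1 - η) * d₁ * Real.exp (-(θ * τ))))
    (hr₁ : θ / r ≤ η) (hr₂ : 1 ≤ τ * r) (hr₃ : r ^ 2 * Real.exp (-(c * r)) ≤ 1 / 8)
    (hr₄ : 6 * d₂ < η * D₁) (hd₁ : 0 < d₁) :
    ∃ R : Fin D₁ → Fin D₂ → Prop, (∀ a, rowDegree R a = d₁) ∧
      (∀ b, rowDegree (fun b a => R a b) b = d₂) ∧
      (∀ S : Finset (Fin D₁), S.Nonempty → (S.card : ℝ) ≤ τ * r →
        (1 - e) * d₁ * S.card * Real.exp (-(θ / r) * S.card) ≤ (uniqueColumns R S).card) ∧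
      ∀ S : Finset (Fin D₂), S.Nonempty → (S.card : ℝ) ≤ τ * r →
        (1 - e) * d₂ * S.card * Real.exp (-(θ / r) * S.card) ≤
          (uniqueColumns (fun b a => R a b) S).card := by
  classical
  have hy : 0 ≤ θ / r := by positivity
  have hp : Real.exp (-(θ / r)) ≤ 1 - (1 - η) * ρ := by
    have h1 : Real.exp (-(θ / r)) ≤ 1 / (1 + θ / r) := by
      rw [Real.exp_neg, ← one_div]
      exact one_div_le_one_div_of_le (by linarith) (by linarith [Real.add_one_le_exp (θ / r)])
    have h2 : 1 / (1 + θ / r) ≤ 1 - (1 - η) * (θ / r) := by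
      rw [div_le_iff₀ (by linarith)]
      have h3 : 0 ≤ η - (1 - η) * (θ / r) := by linarith [mul_nonneg hη₀.le hy]
      linarith [mul_nonneg hy h3]
    have h3 : (1 - η) * ρ ≤ (1 - η) * (θ / r) := mul_le_mul_of_nonneg_left hρ (by linarith)
    linarith
  have hp₁ : (1 - η) * ρ ≤ 1 := by linarith [Real.exp_pos (-(θ / r))]
  have hL : ∀ s : ℕ, (s : ℝ) ≤ τ * r → θ / r * s ≤ θ * τ := by
    intro s hs
    calc θ / r * s ≤ θ / r * (τ * r) := mul_le_mul_of_nonneg_left hs hy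
      _ = θ * τ := by field_simp
  have hmean : ∀ (n d : ℕ), n * ρ = d → d₁ ≤ d → ∀ s : ℕ, 1 ≤ s → (s : ℝ) ≤ τ * r →
      Real.exp (-((η / 2 / 2) ^ 2 * (n * (s * ((1 - η) * ρ * (1 - (1 - η) * ρ) ^ (s - 1)))))) ≤
        Real.exp (-(c * r)) ^ s := by
    intro n d hn hd s hs hsK
    rw [← Real.exp_nat_mul, Real.exp_le_exp, mul_neg, neg_le_neg_iff]
    have h1 := mean_ge hη₀ hη₁ hρ₀ hn hs hy hp
    have h2 : Real.exp (-(θ * τ)) ≤ Real.exp (-(θ / r) * s) := by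
      rw [Real.exp_le_exp]
      linarith [hL s hsK]
    have hdd : (d₁ : ℝ) ≤ d := Nat.cast_le.2 hd
    calc s * (c * r) ≤ s * ((η / 4) ^ 2 * ((1 - η) * d₁ * Real.exp (-(θ * τ)))) :=
          mul_le_mul_of_nonneg_left hc (Nat.cast_nonneg _)
      _ ≤ s * ((η / 4) ^ 2 * ((1 - η) * d * Real.exp (-(θ / r) * s))) := by
          have : 0 ≤ 1 - η := by linarith
          gcongr
      _ = (η / 2 / 2) ^ 2 * ((1 - η) * d * s * Real.exp (-(θ / r) * s)) := by ring
      _ ≤ _ := mul_le_mul_of_nonneg_left h1 (sq_nonneg _)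
  have hx : ∀ n : ℕ, n ≤ D₁ + D₂ → n * Real.exp (-(c * r)) ≤ 1 / 8 := by
    intro n hn
    refine le_trans (mul_le_mul_of_nonneg_right ?_ (Real.exp_pos _).le) hr₃
    rw [← hD]
    exact_mod_cast hn
  obtain ⟨R, hR₁, hR₂⟩ := exists_typical (α := Fin D₁) (β := Fin D₂) (p := (1 - η) * ρ)
    (δ := η / 2) (K := τ * r) (x := Real.exp (-(c * r))) (mul_nonneg (by linarith) hρ₀) hp₁
    (by linarith) (by linarith) hr₂
    (by rw [Fintype.card_fin]; exact hmean D₁ d₂ h₂ h₁₂)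
    (by rw [Fintype.card_fin]; exact hmean D₂ d₁ h₁ le_rfl)
    (by rw [Fintype.card_fin]; exact hx _ (by omega))
    (by rw [Fintype.card_fin]; exact hx _ (by omega))
  obtain ⟨a₁, a₂, a₃⟩ := bounds_of_not_atypical (d := d₂) hη₀ hη₁ hρ₀
    (by rw [Fintype.card_fin]; exact h₂) hy hp hr₂ hR₁
  obtain ⟨b₁, b₂, b₃⟩ := bounds_of_not_atypical (d := d₁) hη₀ hη₁ hρ₀
    (by rw [Fintype.card_fin]; exact h₁) hy hp hr₂ hR₂
  have hcount : D₁ * d₁ = D₂ * d₂ := by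
    have : (D₁ : ℝ) * d₁ = D₂ * d₂ := by rw [← h₁, ← h₂]; ring
    exact_mod_cast this
  set G : Finset (Fin D₁ × Fin D₂) := Finset.univ.filter fun x => R x.1 x.2 with hGdef
  have hG : ∀ a b, (a, b) ∈ G ↔ R a b := by simp [hGdef]
  have hGcard : (G.card : ℝ) ≤ D₁ * ((1 - η / 2) * d₁) := by
    rw [← sum_rowDegree_mem]
    simp only [hG]
    push_cast
    simpa using Finset.sum_le_card_nsmul Finset.univ _ _ fun a _ => b₃ a
  obtain ⟨H, hGH, hH₁, hH₂⟩ := exists_biregular_superset (d₁ := d₁) (d₂ := d₂)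
    (by simpa using hcount) G
    (fun a => by
      simp only [hG]
      have : (d₁ : ℝ) * η ≥ 0 := by positivity
      exact_mod_cast (b₃ a).trans (by linarith : (1 - η / 2) * d₁ ≤ (d₁ : ℝ)))
    (fun b => by
      simp only [hG]
      have : (d₂ : ℝ) * η ≥ 0 := by positivity
      exact_mod_cast (a₃ b).trans (by linarith : (1 - η / 2) * d₂ ≤ (d₂ : ℝ)))
    (by
      rw [Fintype.card_fin]
      have hd₁' : (0 : ℝ) < d₁ := Nat.cast_pos.2 hd₁
      have h3 := mul_lt_mul_of_pos_right hr₄ hd₁'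
      have : (G.card : ℝ) + 3 * d₁ * d₂ < D₁ * d₁ := by linarith
      exact_mod_cast this)
  refine ⟨fun a b => (a, b) ∈ H, hH₁, hH₂, fun S hS hSK => ?_, fun S hS hSK => ?_⟩
  · exact uniqueColumns_ge_of_le (R := R) (fun a b h => hGH ((hG a b).2 h)) hH₁ b₂ hη₀.le hηe
      (hL _ hSK) (b₁ S hS hSK)
  · exact uniqueColumns_ge_of_le (R := fun b a => R a b) (fun b a h => hGH ((hG a b).2 h)) hH₂ a₂
      hη₀.le hηe (hL _ hSK) (a₁ S hS hSK)

/-- Expansion of one-sided sets gives expansion of all sets. -/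
theorem le_expansionProfile_relGraph {α β : Type*} [Fintype α] [Fintype β] [Nonempty (α ⊕ β)]
    {R : α → β → Prop} {d₁ d₂ q y K t : ℝ} (hq : 0 ≤ q) (hd₁ : 0 ≤ d₁) (hd : d₁ ≤ d₂)
    (hy : 0 ≤ y)
    (h₁ : ∀ S : Finset α, S.Nonempty → (S.card : ℝ) ≤ K →
      q * d₁ * S.card * Real.exp (-y * S.card) ≤ (uniqueColumns R S).card)
    (h₂ : ∀ S : Finset β, S.Nonempty → (S.card : ℝ) ≤ K →
      q * d₂ * S.card * Real.exp (-y * S.card) ≤ (uniqueColumns (fun b a => R a b) S).card)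
    (ht : 1 ≤ t) (htK : t ≤ K) :
    q * d₁ * Real.exp (-y * t) ≤ expansionProfile (relGraph R) t := by
  obtain ⟨S, hS, hSt, hr⟩ := (expansionProfile_isLeast (relGraph R) ht).1
  rw [hr, le_div_iff₀ (Nat.cast_pos.2 (Finset.card_pos.2 hS)), card_uniqueNeighbors_relGraph,
    ← Finset.card_toLeft_add_card_toRight]
  have hcard := Finset.card_toLeft_add_card_toRight (u := S)
  have hmono : ∀ s : ℕ, s ≤ S.card → Real.exp (-y * t) ≤ Real.exp (-y * s) := by
    intro s hs
    rw [Real.exp_le_exp]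
    have : (s : ℝ) ≤ t := (Nat.cast_le.2 hs).trans hSt
    nlinarith
  have hK : ∀ s : ℕ, s ≤ S.card → (s : ℝ) ≤ K := fun s hs =>
    (Nat.cast_le.2 hs).trans (hSt.trans htK)
  have e₁ : q * d₁ * S.toLeft.card * Real.exp (-y * t) ≤ (uniqueColumns R S.toLeft).card := by
    rcases S.toLeft.eq_empty_or_nonempty with h | h
    · simp [h]
    · refine le_trans ?_ (h₁ _ h (hK _ (by omega)))
      exact mul_le_mul_of_nonneg_left (hmono _ (by omega)) (by positivity)
  have e₂ : q * d₁ * S.toRight.card * Real.exp (-y * t) ≤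
      (uniqueColumns (fun b a => R a b) S.toRight).card := by
    rcases S.toRight.eq_empty_or_nonempty with h | h
    · simp [h]
    · refine le_trans ?_ (h₂ _ h (hK _ (by omega)))
      have := hmono S.toRight.card (by omega)
      have hd₂ : 0 ≤ d₂ := hd₁.trans hd
      gcongr
  push_cast
  linarith

/-! ### The error term -/

/-- If for every `e > 0` an upward closed condition on `(n, e)` holds for all large `n`, and
`(n, 1)` satisfies it for all `n`, then it holds along a null sequence. -/
theorem exists_tendsto_zero_of_eventually {P : ℕ → ℝ → Prop}
    (hmono : ∀ n e e', e ≤ e' → P n e → P n e') (hone : ∀ n, P n 1)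
    (hev : ∀ e, 0 < e → ∀ᶠ n in atTop, P n e) :
    ∃ ε : ℕ → ℝ, Tendsto ε atTop (𝓝 0) ∧ ∀ n, P n (ε n) := by
  set A : ℕ → Set ℝ := fun n => {e | 0 ≤ e ∧ P n e} with hA
  have hbdd : ∀ n, BddBelow (A n) := fun n => ⟨0, fun e he => he.1⟩
  have hnn : ∀ n, 0 ≤ sInf (A n) := fun n => Real.sInf_nonneg fun e he => he.1
  -- adding `1 / (n + 1)` sidesteps the question whether the infimum is attained
  refine ⟨fun n => sInf (A n) + 1 / ((n : ℝ) + 1), ?_, fun n => ?_⟩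
  · have h0 : Tendsto (fun n => sInf (A n)) atTop (𝓝 0) := by
      rw [Metric.tendsto_atTop']
      intro e he
      obtain ⟨N, hN⟩ := eventually_atTop.1 (hev (e / 2) (by linarith))
      refine ⟨N, fun n hn => ?_⟩
      have := csInf_le (hbdd n) ⟨by linarith, hN n hn.le⟩
      rw [Real.dist_eq, sub_zero, abs_of_nonneg (hnn n)]
      linarith
    simpa using h0.add tendsto_one_div_add_atTop_nhds_zero_nat
  · have hpos : 0 < 1 / ((n : ℝ) + 1) := by positivity
    obtain ⟨e, he, hlt⟩ := exists_lt_of_csInf_lt (s := A n) ⟨1, zero_le_one, hone n⟩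
      (lt_add_of_pos_right (sInf (A n)) hpos)
    exact hmono n e _ hlt.le he.2

theorem expansionProfile_nonneg {V : Type*} [Fintype V] (H : SimpleGraph V) (t : ℝ) :
    0 ≤ expansionProfile H t := by
  refine Real.sInf_nonneg ?_
  rintro r ⟨S, -, -, rfl⟩
  positivity

/-- All admissible parameters with `D₁ + D₂ = n` admit a biregular graph whose expansion profile is
within a factor `1 - e` of the ideal one. -/
def ExpandersExist (β θ τ : ℝ) (n : ℕ) (e : ℝ) : Prop :=
  ∀ d₁ d₂ D₁ D₂ : ℕ, D₁ + D₂ = n →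
    (d₁ : ℝ) / (d₂ : ℝ) = (D₂ : ℝ) / (D₁ : ℝ) →
    (d₁ : ℝ) / (d₂ : ℝ) ≤ 1 →
    β / (1 - β) ≤ (d₁ : ℝ) / (d₂ : ℝ) →
    θ * √((D₁ + D₂ : ℕ) : ℝ) / 2 ≤ (d₁ : ℝ) + (d₂ : ℝ) →
    (d₁ : ℝ) + (d₂ : ℝ) ≤ θ * √((D₁ + D₂ : ℕ) : ℝ) →
    d₁ ≤ D₂ →
    ∃ H : SimpleGraph (Fin D₁ ⊕ Fin D₂), IsBiregular H d₁ d₂ ∧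
      ∀ t : ℝ, 1 ≤ t → t ≤ τ * √((D₁ + D₂ : ℕ) : ℝ) →
        (1 - e) * (d₁ : ℝ) * Real.exp (-θ * t / √((D₁ + D₂ : ℕ) : ℝ)) ≤ expansionProfile H t

theorem lemma4p4 (β θ τ : ℝ) (hβ₀ : 0 < β) (hβ₁ : β ≤ 1 / 2) (hθ : 0 < θ) (hτ : 0 < τ) :
    ∃ ε : ℕ → ℝ, Tendsto ε atTop (𝓝 0) ∧
      ∀ d₁ d₂ D₁ D₂ : ℕ,
        (d₁ : ℝ) / (d₂ : ℝ) = (D₂ : ℝ) / (D₁ : ℝ) →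
        (d₁ : ℝ) / (d₂ : ℝ) ≤ 1 →
        β / (1 - β) ≤ (d₁ : ℝ) / (d₂ : ℝ) →
        θ * √((D₁ + D₂ : ℕ) : ℝ) / 2 ≤ (d₁ : ℝ) + (d₂ : ℝ) →
        (d₁ : ℝ) + (d₂ : ℝ) ≤ θ * √((D₁ + D₂ : ℕ) : ℝ) →
        d₁ ≤ D₂ →
        ∃ H : SimpleGraph (Fin D₁ ⊕ Fin D₂), IsBiregular H d₁ d₂ ∧
          ∀ t : ℝ, 1 ≤ t → t ≤ τ * √((D₁ + D₂ : ℕ) : ℝ) →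
            (1 - ε (D₁ + D₂)) * (d₁ : ℝ) * Real.exp (-θ * t / √((D₁ + D₂ : ℕ) : ℝ)) ≤
              expansionProfile H t := by
  suffices h : ∃ ε : ℕ → ℝ, Tendsto ε atTop (𝓝 0) ∧ ∀ n, ExpandersExist β θ τ n (ε n) by
    obtain ⟨ε, hε, h⟩ := h
    exact ⟨ε, hε, fun d₁ d₂ D₁ D₂ => h _ d₁ d₂ D₁ D₂ rfl⟩
  have hβ₂ : 0 < 1 - β := by linarith
  have hpos : ∀ d₁ d₂ D₁ D₂ : ℕ, (d₁ : ℝ) / (d₂ : ℝ) = (D₂ : ℝ) / (D₁ : ℝ) →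
      β / (1 - β) ≤ (d₁ : ℝ) / (d₂ : ℝ) →
      0 < (d₁ : ℝ) ∧ 0 < (d₂ : ℝ) ∧ 0 < (D₁ : ℝ) ∧ 0 < (D₂ : ℝ) ∧ (d₁ : ℝ) * D₁ = d₂ * D₂ := by
    intro d₁ d₂ D₁ D₂ h₁ h₂
    have h0 : 0 < (d₁ : ℝ) / d₂ := lt_of_lt_of_le (by positivity) h₂
    -- a vanishing denominator would make the quotient `0`
    have p1 : (d₁ : ℝ) ≠ 0 := by intro h; simp [h] at h0
    have p2 : (d₂ : ℝ) ≠ 0 := by intro h; simp [h] at h0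
    have p3 : (D₁ : ℝ) ≠ 0 := by intro h; rw [h₁] at h0; simp [h] at h0
    have p4 : (D₂ : ℝ) ≠ 0 := by intro h; rw [h₁] at h0; simp [h] at h0
    refine ⟨by positivity, by positivity, by positivity, by positivity, ?_⟩
    rw [div_eq_div_iff p2 p3] at h₁
    linarith
  refine exists_tendsto_zero_of_eventually ?_ ?_ ?_
  · intro n e e' hee h d₁ d₂ D₁ D₂ hn c1 c2 c3 c4 c5 c6
    obtain ⟨H, hH, hP⟩ := h d₁ d₂ D₁ D₂ hn c1 c2 c3 c4 c5 c6
    refine ⟨H, hH, fun t ht htK => le_trans ?_ (hP t ht htK)⟩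
    gcongr
  · intro n d₁ d₂ D₁ D₂ hn c1 c2 c3 c4 c5 c6
    obtain ⟨p1, p2, p3, p4, hcount⟩ := hpos d₁ d₂ D₁ D₂ c1 c3
    obtain ⟨R, hR₁, hR₂⟩ := exists_biregular_relation (d₁ := d₁) (d₂ := d₂) (D₁ := D₁) (D₂ := D₂)
      (by exact_mod_cast hcount) c6 (by exact_mod_cast p1)
    refine ⟨relGraph R, isBiregular_relGraph hR₁ hR₂, fun t _ _ => ?_⟩
    simpa using expansionProfile_nonneg (relGraph R) t
  · intro e₀ he₀
    -- capped at `1`: combining the two sides of a set needs `0 ≤ 1 - e`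
    set e : ℝ := min e₀ 1 with he
    have he0 : 0 < e := lt_min he₀ one_pos
    have he1 : e ≤ 1 := min_le_right _ _
    set η : ℝ := e / (2 + 2 * Real.exp (θ * τ)) with hη
    have hden : 4 ≤ 2 + 2 * Real.exp (θ * τ) := by
      have : 1 ≤ Real.exp (θ * τ) := Real.one_le_exp (by positivity)
      linarith
    have hη₀ : 0 < η := by positivity
    have hη₁ : η ≤ 1 / 4 := by
      rw [hη, div_le_iff₀ (by linarith)]
      linarith
    have hηe : η * (2 + 2 * Real.exp (θ * τ)) = e := by
      rw [hη]
      field_simp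
    set c : ℝ := (η / 4) ^ 2 * (1 / 2 * (β * θ / 2) * Real.exp (-(θ * τ))) with hc
    have hc0 : 0 < c := by positivity
    have hlim : Tendsto (fun r : ℝ => r ^ 2 * Real.exp (-(c * r))) atTop (𝓝 0) := by
      have h1 := ((Real.tendsto_pow_mul_exp_neg_atTop_nhds_zero 2).comp
        (tendsto_id.const_mul_atTop hc0)).const_mul (1 / c ^ 2)
      rw [mul_zero] at h1
      refine h1.congr fun r => ?_
      simp only [Function.comp, id]
      field_simp
    have hsqrt : Tendsto (fun n : ℕ => √(n : ℝ)) atTop atTop :=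
      Real.tendsto_sqrt_atTop.comp tendsto_natCast_atTop_atTop
    filter_upwards [hsqrt.eventually (hlim.eventually (ge_mem_nhds (by norm_num : (0 : ℝ) < 1 / 8))),
      hsqrt.eventually (eventually_gt_atTop 0), hsqrt.eventually (eventually_ge_atTop (1 / τ)),
      hsqrt.eventually (eventually_gt_atTop (12 * θ / η))] with n hr₃ hr hr₂ hr₄
    intro d₁ d₂ D₁ D₂ hn c1 c2 c3 c4 c5 c6
    obtain ⟨p1, p2, p3, p4, hcount⟩ := hpos d₁ d₂ D₁ D₂ c1 c3
    rw [hn] at c4 c5 ⊢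
    set r : ℝ := √(n : ℝ) with hrdef
    have hD : ((D₁ + D₂ : ℕ) : ℝ) = r ^ 2 := by
      rw [hn, hrdef, Real.sq_sqrt (Nat.cast_nonneg _)]
    have hD' : (D₁ : ℝ) + D₂ = r ^ 2 := by rw [← hD]; push_cast; rfl
    have h₁₂ : (d₁ : ℝ) ≤ d₂ := by rwa [div_le_one p2] at c2
    have hD₂₁ : (D₂ : ℝ) ≤ D₁ := by rwa [c1, div_le_one p3] at c2
    have hβd : β * d₂ ≤ d₁ * (1 - β) := by rwa [div_le_div_iff₀ hβ₂ p2] at c3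
    have h₂ : (D₁ : ℝ) * (d₂ / D₁) = d₂ := by field_simp
    have h₁ : (D₂ : ℝ) * (d₂ / D₁) = d₁ := by
      field_simp
      linarith
    have hρ : (d₂ : ℝ) / D₁ ≤ θ / r := by
      have hsum : (d₂ : ℝ) / D₁ * r ^ 2 = d₁ + d₂ := by rw [← hD', ← h₁]; nth_rw 3 [← h₂]; ring
      rw [le_div_iff₀ hr]
      refine le_of_mul_le_mul_right ?_ hr
      linarith
    rw [div_lt_iff₀ hη₀] at hr₄
    have hbig : 6 * (d₂ : ℝ) < η * D₁ := by
      have h3 := mul_lt_mul_of_pos_right hr₄ hr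
      have h4 : η * r ^ 2 ≤ η * (2 * D₁) := mul_le_mul_of_nonneg_left (by linarith) hη₀.le
      nlinarith
    obtain ⟨R, hR₁, hR₂, hS₁, hS₂⟩ := exists_biregular_of_large (τ := τ) (c := c) hθ hη₀ hη₁ hηe hr
      hD (by positivity) hρ h₁ h₂ (by exact_mod_cast h₁₂)
      (by
        have h3 : β * θ / 2 * r ≤ d₁ := by
          have := mul_le_mul_of_nonneg_left c4 hβ₀.le
          linarith
        calc c * r = (η / 4) ^ 2 * (1 / 2 * (β * θ / 2 * r) * Real.exp (-(θ * τ))) := by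
              rw [hc]; ring
          _ ≤ _ := by
              have : 1 / 2 ≤ 1 - η := by linarith
              gcongr)
      (by
        rw [div_le_iff₀ hr]
        linarith)
      (by
        rw [div_le_iff₀ hτ] at hr₂
        linarith) hr₃ hbig (by exact_mod_cast p1)
    refine ⟨relGraph R, isBiregular_relGraph hR₁ hR₂, fun t ht htK => ?_⟩
    have : Nonempty (Fin D₁ ⊕ Fin D₂) := ⟨Sum.inl ⟨0, by exact_mod_cast p3⟩⟩
    refine le_trans ?_ (le_expansionProfile_relGraph (by linarith : 0 ≤ 1 - e) p1.le h₁₂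
      (by positivity : 0 ≤ θ / r) hS₁ hS₂ ht htK)
    rw [show -θ * t / r = -(θ / r) * t by ring]
    have : e ≤ e₀ := min_le_left _ _
    gcongr
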